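/- Let $N\ge 0$ and write $\mathbb{E}^N$ for Euclidean $N$-space. A smocking pattern in $\mathbb{E}^N$ is a finite or countable (possibly empty) collection of pairwise disjoint nonempty compact connected subsets of $\mathbb{E}^N$, called stitches, for which there is a $\delta>0$ such that $|z-z'|\ge\delta$ whenever $z,z'$ lie in different stitches. Its smocked space $X$ is the quotient of $\mathbb{E}^N$ in which each stitch is identified to a point; with quotient map $\pi:\mathbb{E}^N\to X$, it carries the metric $$d(p,q)=\inf\Big\{|v-z_1|+\sum_{i=1}^{m-1}|z_i'-z_{i+1}|+|z_m'-w|\Big\},$$ where the infimum is over all $v\in\pi^{-1}(p)$, $w\in\pi^{-1}(q)$, all $m\ge 0$, all finite sequences of stitches $I_1,\dots,I_m$ with $I_i\ne I_{i+1}$, and all $z_i,z_i'\in I_i$ (for $m=0$ the sum is $|v-w|$). With this metric $X$ is a proper metric space. **Proposition 3.3.** For $k\in\mathbb{N}$ let $\{S^{(k)}_\alpha\}_{\alpha\in\mathcal{A}_k}$ be a smocking pattern in $\mathbb{E}^N$ with smocked space $X_k$, quotient map $\pi_k$ and base point $x_k=\pi_k(0)$, and let $\{S^{(\infty)}_\beta\}_{\beta\in\mathcal{A}_\infty}$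 be a smocking pattern in $\mathbb{E}^N$ with smocked space $X_\infty$, quotient map $\pi_\infty$ and base point $x_\infty=\pi_\infty(0)$. For $R>0$ let $\overline{B_R}$ be the closed Euclidean ball of radius $R$ about $0$. Assume: (H1) For every $R>0$, $$d_H\Big(\bigcup_{\alpha:\,S^{(k)}_\alpha\cap\overline{B_R}\ne\varnothing}S^{(k)}_\alpha,\ \bigcup_{\beta:\,S^{(\infty)}_\beta\cap\overline{B_R}\ne\varnothing}S^{(\infty)}_\beta\Big)\xrightarrow[k\to\infty]{}0,$$ where $d_H$ is the Hausdorff distance, with $d_H(\varnothing,\varnothing)=0$ and $d_H(\varnothing,A)=\infty$ for $A\neq\varnothing$. (H2) For every $R>0$ there exist $L_R<\infty$, $\delta_R>0$ and $K_R\in\mathbb{N}$ such that for all $k\ge K_R$ every stitch $S^{(k)}_\alpha$ that meets $\overline{B_R}$ has diameter at most $L_R$, and $|z-z'|\ge\delta_R$ whenever $z,z'$ lie in different stitches $S^{(k)}_\alpha,S^{(k)}_{\alpha'}$ that both meet $\overline{B_R}$. Then $(X_k,x_k)\to(X_\infty,x_\infty)$ in the pointed Gromov–Hausdorff sense: for every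 $R>0$ the Gromov–Hausdorff distance between the closed balls of radius $R$ about $x_k$ in $X_k$ and about $x_\infty$ in $X_\infty$ tends to $0$ as $k\to\infty$. -/

import Mathlib

/-- A smocking pattern in Euclidean `N`-space: a finite or countable collection of pairwise
disjoint (nonempty) compact connected sets, the stitches, with a positive separation factor. -/
structure Smocking (N : ℕ) where
  stitches : Set (Set (EuclideanSpace ℝ (Fin N)))
  countable : stitches.Countable
  isCompact : ∀ I ∈ stitches, IsCompact I
  isConnected : ∀ I ∈ stitches, IsConnected I
  disjoint : stitches.PairwiseDisjoint id
  separated : ∃ δ : ℝ, 0 < δ ∧ ∀ I ∈ stitches, ∀ J ∈ stitches, I ≠ J →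
    ∀ x ∈ I, ∀ y ∈ J, δ ≤ dist x y

namespace Smocking

variable {N : ℕ} (S : Smocking N)

/-- Two points are identified when they are equal or lie in a common stitch. -/
def Rel (x y : EuclideanSpace ℝ (Fin N)) : Prop :=
  x = y ∨ ∃ I ∈ S.stitches, x ∈ I ∧ y ∈ I

theorem eq_of_mem {I J : Set (EuclideanSpace ℝ (Fin N))} (hI : I ∈ S.stitches)
    (hJ : J ∈ S.stitches) {x : EuclideanSpace ℝ (Fin N)} (hxI : x ∈ I) (hxJ : x ∈ J) :
    I = J := by
  by_contra h
  exact Set.disjoint_left.1 (S.disjoint hI hJ h) hxI hxJ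

/-- The equivalence relation that collapses every stitch to a point. -/
def setoid : Setoid (EuclideanSpace ℝ (Fin N)) where
  r := S.Rel
  iseqv :=
    { refl := fun _ => Or.inl rfl
      symm := by
        rintro x y (h | ⟨I, hI, hx, hy⟩)
        · exact Or.inl h.symm
        · exact Or.inr ⟨I, hI, hy, hx⟩
      trans := by
        rintro x y z (rfl | ⟨I, hI, hx, hy⟩) (rfl | ⟨J, hJ, hy', hz⟩)
        · exact Or.inl rfl
        · exact Or.inr ⟨J, hJ, hy', hz⟩
        · exact Or.inr ⟨I, hI, hx, hy⟩
        · obtain rfl := S.eq_of_mem hI hJ hy hy'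
          exact Or.inr ⟨I, hI, hx, hz⟩ }

/-- The smocked space: Euclidean space with every stitch collapsed to a point. -/
def Space : Type := Quotient S.setoid

/-- The smocking map. -/
def proj (x : EuclideanSpace ℝ (Fin N)) : S.Space := Quotient.mk S.setoid x

theorem proj_eq_iff {x y : EuclideanSpace ℝ (Fin N)} : S.proj x = S.proj y ↔ S.Rel x y :=
  Quotient.eq (r := S.setoid)

theorem proj_surjective : Function.Surjective S.proj := Quotient.mk_surjective

/-- The passage through a stitch: it is entered at one point and left at another, at no cost. -/
structure Crossing where
  stitch : Set (EuclideanSpace ℝ (Fin N))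
  stitch_mem : stitch ∈ S.stitches
  entry : EuclideanSpace ℝ (Fin N)
  exit : EuclideanSpace ℝ (Fin N)
  entry_mem : entry ∈ stitch
  exit_mem : exit ∈ stitch

variable {S}

/-- The sum of the lengths of the segments
`|v - z₁| + |z₁' - z₂| + ⋯ + |zₖ₋₁' - zₖ| + |zₖ' - w|` of the path from `v` to `w` through the
listed stitches (entered at `zᵢ`, left at `zᵢ'`); it is `|v - w|` for the empty list. -/
noncomputable def pathLength (v w : EuclideanSpace ℝ (Fin N)) : List S.Crossing → ℝ
  | [] => dist v w
  | c :: l => dist v c.entry + pathLength c.exit w l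

/-- Consecutive stitches of the path are different: `j₁ ≠ j₂ ≠ ⋯ ≠ jₖ`. -/
def Admissible (l : List S.Crossing) : Prop := l.IsChain (fun c d => c.stitch ≠ d.stitch)

/-- The smocked distance: the infimum of the lengths of all paths, through any finite number of
stitches, between representatives of the two points. -/
noncomputable instance : Dist S.Space where
  dist p q := sInf {r : ℝ | ∃ v w : EuclideanSpace ℝ (Fin N), ∃ l : List S.Crossing,
    S.proj v = p ∧ S.proj w = q ∧ Admissible l ∧ pathLength v w l = r}

theorem dist_def (p q : S.Space) : dist p q =
    sInf {r : ℝ | ∃ v w : EuclideanSpace ℝ (Fin N), ∃ l : List S.Crossing,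
      S.proj v = p ∧ S.proj w = q ∧ Admissible l ∧ pathLength v w l = r} := rfl

theorem pathLength_nonneg (v w : EuclideanSpace ℝ (Fin N)) (l : List S.Crossing) :
    0 ≤ pathLength v w l := by
  induction l generalizing v with
  | nil => exact dist_nonneg
  | cons c l ih => exact add_nonneg dist_nonneg (ih _)

theorem pathLength_append_cons (v w : EuclideanSpace ℝ (Fin N)) (l m : List S.Crossing)
    (c : S.Crossing) :
    pathLength v w (l ++ c :: m) = pathLength v c.entry l + pathLength c.exit w m := by
  induction l generalizing v with
  | nil => rfl
  | cons d l ih => simp only [List.cons_append, pathLength, ih, add_assoc]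

theorem pathLength_le_dist_add (v u w : EuclideanSpace ℝ (Fin N)) (l : List S.Crossing) :
    pathLength v w l ≤ dist v u + pathLength u w l := by
  cases l with
  | nil => exact dist_triangle _ _ _
  | cons c l =>
    have := dist_triangle v u c.entry
    simp only [pathLength]
    linarith

theorem pathLength_append_le (v u w : EuclideanSpace ℝ (Fin N)) (l m : List S.Crossing) :
    pathLength v w (l ++ m) ≤ pathLength v u l + pathLength u w m := by
  induction l generalizing v with
  | nil => exact pathLength_le_dist_add v u w m
  | cons c l ih =>
    have := ih c.exit
    simp only [List.cons_append, pathLength]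
    linarith

/-- Allowing a stitch to be repeated consecutively does not produce shorter paths. -/
theorem exists_admissible (v w : EuclideanSpace ℝ (Fin N)) (l : List S.Crossing) :
    ∃ m : List S.Crossing, Admissible m ∧ pathLength v w m ≤ pathLength v w l := by
  induction l generalizing v with
  | nil => exact ⟨[], List.IsChain.nil, le_rfl⟩
  | cons c l ih =>
    obtain ⟨m, hm, hle⟩ := ih c.exit
    cases m with
    | nil =>
      refine ⟨[c], List.IsChain.singleton _, ?_⟩
      simp only [pathLength] at hle ⊢
      linarith
    | cons d m =>
      by_cases h : c.stitch = d.stitch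
      · refine ⟨⟨c.stitch, c.stitch_mem, c.entry, d.exit, c.entry_mem, h ▸ d.exit_mem⟩ :: m,
          ?_, ?_⟩
        · cases m with
          | nil => exact List.IsChain.singleton _
          | cons e m =>
            simp only [Admissible, List.isChain_cons_cons] at hm ⊢
            exact ⟨h ▸ hm.1, hm.2⟩
        · have := dist_nonneg (x := c.exit) (y := d.entry)
          simp only [pathLength] at hle ⊢
          linarith
      · refine ⟨c :: d :: m, ?_, ?_⟩
        · simp only [Admissible, List.isChain_cons_cons] at hm ⊢
          exact ⟨h, hm⟩
        · simp only [pathLength] at hle ⊢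
          linarith

theorem exists_reverse (v w : EuclideanSpace ℝ (Fin N)) (l : List S.Crossing) :
    ∃ m : List S.Crossing, pathLength w v m = pathLength v w l := by
  induction l generalizing v with
  | nil => exact ⟨[], dist_comm _ _⟩
  | cons c l ih =>
    obtain ⟨m, hm⟩ := ih c.exit
    refine ⟨m ++ [⟨c.stitch, c.stitch_mem, c.exit, c.entry, c.exit_mem, c.entry_mem⟩], ?_⟩
    rw [pathLength_append_cons]
    simp only [pathLength]
    rw [hm, dist_comm c.entry v, add_comm]

theorem dist_le_pathLength (v w : EuclideanSpace ℝ (Fin N)) (l : List S.Crossing) :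
    dist (S.proj v) (S.proj w) ≤ pathLength v w l := by
  obtain ⟨m, hm, hle⟩ := exists_admissible v w l
  refine le_trans (csInf_le ⟨0, ?_⟩ ⟨v, w, m, rfl, rfl, hm, rfl⟩) hle
  rintro r ⟨_, _, _, _, _, _, rfl⟩
  exact pathLength_nonneg _ _ _

theorem le_dist_proj {p q : S.Space} {a : ℝ}
    (h : ∀ (v w : EuclideanSpace ℝ (Fin N)) (l : List S.Crossing),
      S.proj v = p → S.proj w = q → Admissible l → a ≤ pathLength v w l) : a ≤ dist p q := by
  obtain ⟨v, rfl⟩ := S.proj_surjective p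
  obtain ⟨w, rfl⟩ := S.proj_surjective q
  refine le_csInf ⟨_, v, w, [], rfl, rfl, List.IsChain.nil, rfl⟩ ?_
  rintro r ⟨v', w', l, hv, hw, hl, rfl⟩
  exact h v' w' l hv hw hl

theorem exists_pathLength_lt {p q : S.Space} {a : ℝ} (h : dist p q < a) :
    ∃ (v w : EuclideanSpace ℝ (Fin N)) (l : List S.Crossing),
      S.proj v = p ∧ S.proj w = q ∧ Admissible l ∧ pathLength v w l < a := by
  by_contra! hc
  exact absurd (le_dist_proj hc) (not_le.2 h)

theorem dist_self_aux (p : S.Space) : dist p p = 0 := by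
  refine le_antisymm ?_ (le_dist_proj fun v w l _ _ _ => pathLength_nonneg v w l)
  obtain ⟨v, rfl⟩ := S.proj_surjective p
  simpa [pathLength] using dist_le_pathLength (S := S) v v []

theorem dist_comm_aux (p q : S.Space) : dist p q = dist q p := by
  have key : ∀ p q : S.Space, dist p q ≤ dist q p := by
    refine fun p q => le_dist_proj ?_
    rintro v w l rfl rfl -
    obtain ⟨m, hm⟩ := exists_reverse v w l
    exact hm ▸ dist_le_pathLength w v m
  exact le_antisymm (key p q) (key q p)

theorem dist_triangle_aux (p q r : S.Space) : dist p r ≤ dist p q + dist q r := by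
  refine le_of_forall_pos_le_add fun ε hε => ?_
  obtain ⟨v, w, l, rfl, hw, -, hl⟩ :=
    exists_pathLength_lt (show dist p q < dist p q + ε / 2 by linarith)
  obtain ⟨w', x, m, hw', rfl, -, hm⟩ :=
    exists_pathLength_lt (show dist q r < dist q r + ε / 2 by linarith)
  rcases S.proj_eq_iff.1 (hw.trans hw'.symm) with rfl | ⟨I, hI, h1, h2⟩
  · have h3 := dist_le_pathLength v x (l ++ m)
    have h4 := pathLength_append_le v w x l m
    linarith
  · have h3 := dist_le_pathLength v x (l ++ (⟨I, hI, w, w', h1, h2⟩ : S.Crossing) :: m)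
    rw [pathLength_append_cons] at h3
    linarith

variable (S) in
/-- A point, or a stitch, has positive distance from all (other) stitches. -/
theorem exists_gap (v : EuclideanSpace ℝ (Fin N)) : ∃ ε : ℝ, 0 < ε ∧ ∀ v', S.Rel v' v →
    ∀ I ∈ S.stitches, v ∉ I → ∀ z ∈ I, ε ≤ dist v' z := by
  obtain ⟨δ, hδ, hsep⟩ := S.separated
  by_cases hv : ∃ J ∈ S.stitches, v ∈ J
  · obtain ⟨J, hJ, hvJ⟩ := hv
    refine ⟨δ, hδ, fun v' hv' I hI hvI z hz => ?_⟩
    have hv'J : v' ∈ J := by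
      rcases hv' with rfl | ⟨J', hJ', h1, h2⟩
      · exact hvJ
      · exact S.eq_of_mem hJ' hJ h2 hvJ ▸ h1
    exact hsep J hJ I hI (fun h => hvI (h ▸ hvJ)) v' hv'J z hz
  · push Not at hv
    have hrel : ∀ v', S.Rel v' v → v' = v := by
      rintro v' (h | ⟨J, hJ, -, h⟩)
      · exact h
      · exact absurd h (hv J hJ)
    by_cases hnear : ∃ J ∈ S.stitches, ∃ y ∈ J, dist v y < δ / 2
    · obtain ⟨J, hJ, y, hy, hvy⟩ := hnear
      have hpos : 0 < Metric.infDist v J :=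
        ((S.isCompact J hJ).isClosed.notMem_iff_infDist_pos ⟨y, hy⟩).1 (hv J hJ)
      refine ⟨min (δ / 2) (Metric.infDist v J), lt_min (by linarith) hpos, ?_⟩
      intro v' hv' I hI _ z hz
      rw [hrel v' hv']
      by_cases hIJ : J = I
      · exact (min_le_right _ _).trans (Metric.infDist_le_dist_of_mem (hIJ ▸ hz))
      · have h1 := hsep J hJ I hI hIJ y hy z hz
        have h2 := dist_triangle_left y z v
        exact (min_le_left _ _).trans (by linarith)
    · push Not at hnear
      exact ⟨δ / 2, by linarith, fun v' hv' I hI _ z hz => hrel v' hv' ▸ hnear I hI z hz⟩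

theorem eq_of_dist_eq_zero_aux {p q : S.Space} (h : dist p q = 0) : p = q := by
  by_contra hne
  obtain ⟨v, rfl⟩ := S.proj_surjective p
  obtain ⟨w, rfl⟩ := S.proj_surjective q
  obtain ⟨ε, hε, hv⟩ := S.exists_gap v
  obtain ⟨η, hη, hw⟩ := S.exists_gap w
  rw [S.proj_eq_iff] at hne
  have hvw : 0 < dist v w := dist_pos.2 fun h => hne (Or.inl h)
  have hor : ∀ I ∈ S.stitches, v ∈ I → w ∉ I := fun I hI h1 h2 => hne (Or.inr ⟨I, hI, h1, h2⟩)
  have hpos : 0 < min (dist v w) (min ε η) := lt_min hvw (lt_min hε hη)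
  refine absurd h (ne_of_gt (hpos.trans_le (le_dist_proj fun v' w' l hv' hw' hl => ?_)))
  rw [S.proj_eq_iff] at hv' hw'
  have e1 : min (dist v w) (min ε η) ≤ ε := (min_le_right _ _).trans (min_le_left _ _)
  have e2 : min (dist v w) (min ε η) ≤ η := (min_le_right _ _).trans (min_le_right _ _)
  cases l with
  | nil =>
    rcases hv' with rfl | ⟨I, hI, h1, h2⟩
    · rcases hw' with rfl | ⟨J, hJ, h3, h4⟩
      · exact min_le_left _ _
      · exact e1.trans (hv _ (Or.inl rfl) J hJ (fun h => hor J hJ h h4) w' h3)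
    · refine e2.trans ?_
      simp only [pathLength]
      rw [dist_comm]
      exact hw w' hw' I hI (hor I hI h2) v' h1
  | cons c l =>
    by_cases hvc : v ∈ c.stitch
    · refine le_trans ?_ (le_add_of_nonneg_left dist_nonneg)
      have hr : S.Rel c.exit v := Or.inr ⟨c.stitch, c.stitch_mem, c.exit_mem, hvc⟩
      cases l with
      | nil =>
        refine e2.trans ?_
        simp only [pathLength]
        rw [dist_comm]
        exact hw w' hw' c.stitch c.stitch_mem (hor _ c.stitch_mem hvc) _ c.exit_mem
      | cons d l =>
        simp only [Admissible, List.isChain_cons_cons] at hl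
        refine e1.trans (le_trans ?_ (le_add_of_nonneg_right (pathLength_nonneg _ _ _)))
        exact hv _ hr d.stitch d.stitch_mem
          (fun h => hl.1 (S.eq_of_mem c.stitch_mem d.stitch_mem hvc h)) _ d.entry_mem
    · refine e1.trans (le_trans ?_ (le_add_of_nonneg_right (pathLength_nonneg _ _ _)))
      exact hv v' hv' c.stitch c.stitch_mem hvc _ c.entry_mem

/-- The smocked space with the smocked distance is a metric space. -/
noncomputable instance : MetricSpace S.Space where
  dist_self := dist_self_aux
  dist_comm := dist_comm_aux
  dist_triangle := dist_triangle_aux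
  eq_of_dist_eq_zero := eq_of_dist_eq_zero_aux

theorem dist_proj_le (v w : EuclideanSpace ℝ (Fin N)) :
    dist (S.proj v) (S.proj w) ≤ dist v w := dist_le_pathLength (S := S) v w []

theorem continuous_proj : Continuous S.proj :=
  (LipschitzWith.of_dist_le_mul (K := 1) fun v w => by simpa using dist_proj_le v w).continuous

variable (S) in
theorem finite_meeting {A : Set (EuclideanSpace ℝ (Fin N))} (hA : Bornology.IsBounded A) :
    {I ∈ S.stitches | (I ∩ A).Nonempty}.Finite := by
  obtain ⟨δ, hδ, hsep⟩ := S.separated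
  obtain ⟨t, ht, hAt⟩ := Metric.totallyBounded_iff.1
    ((Metric.isCompact_of_isClosed_isBounded isClosed_closure hA.closure).totallyBounded.subset
      subset_closure) (δ / 2) (by linarith)
  have hex : ∀ I ∈ {I ∈ S.stitches | (I ∩ A).Nonempty}, ∃ y ∈ t, ∃ z ∈ I, dist z y < δ / 2 := by
    rintro I ⟨-, z, hz, hzA⟩
    obtain ⟨y, hy, hzy⟩ := Set.mem_iUnion₂.1 (hAt hzA)
    exact ⟨y, hy, z, hz, hzy⟩
  choose! f hf z hz hd using hex
  refine Set.Finite.of_finite_image (f := f) (ht.subset (by rintro _ ⟨I, hI, rfl⟩; exact hf I hI))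
    fun I hI J hJ hIJ => ?_
  by_contra hne
  have h1 := hsep I hI.1 J hJ.1 hne _ (hz I hI) _ (hz J hJ)
  have h2 := hd I hI
  have h3 := hd J hJ
  have h4 := dist_triangle_right (z I) (z J) (f I)
  rw [← hIJ] at h3
  linarith

variable (S) in
theorem isBounded_saturation {A : Set (EuclideanSpace ℝ (Fin N))} (hA : Bornology.IsBounded A) :
    Bornology.IsBounded {x | ∃ a ∈ A, S.Rel a x} := by
  have hfin : Bornology.IsBounded (⋃ I ∈ {I ∈ S.stitches | (I ∩ A).Nonempty}, I) :=
    (Bornology.isBounded_biUnion (S.finite_meeting hA)).2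
      fun I hI => (S.isCompact I hI.1).isBounded
  refine (hA.union hfin).subset ?_
  rintro x ⟨a, ha, rfl | ⟨I, hI, haI, hxI⟩⟩
  · exact Or.inl ha
  · exact Or.inr (Set.mem_iUnion₂.2 ⟨I, ⟨hI, a, haI, ha⟩, hxI⟩)

variable (S) in
theorem isBounded_endpoints (r : ℝ) (n : ℕ) :
    ∀ A : Set (EuclideanSpace ℝ (Fin N)), Bornology.IsBounded A →
      Bornology.IsBounded {w | ∃ v ∈ A, ∃ l : List S.Crossing, l.length ≤ n ∧
        pathLength v w l ≤ r} := by
  induction n with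
  | zero =>
    refine fun A hA => (hA.cthickening (δ := r)).subset ?_
    rintro w ⟨v, hv, l, hl, hr⟩
    obtain rfl : l = [] := List.length_eq_zero_iff.1 (Nat.le_zero.1 hl)
    exact Metric.mem_cthickening_of_dist_le w v r A hv (by rwa [dist_comm])
  | succ n ih =>
    intro A hA
    refine ((hA.cthickening (δ := r)).union
      (ih _ (S.isBounded_saturation (hA.cthickening (δ := r))))).subset ?_
    rintro w ⟨v, hv, l, hl, hr⟩
    cases l with
    | nil => exact Or.inl (Metric.mem_cthickening_of_dist_le w v r A hv (by rwa [dist_comm]))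
    | cons c l =>
      have h1 := pathLength_nonneg c.exit w l
      have h2 := dist_nonneg (x := v) (y := c.entry)
      simp only [pathLength] at hr
      refine Or.inr ⟨c.exit, ⟨c.entry, ?_, ?_⟩, l, by simpa using hl, by linarith⟩
      · exact Metric.mem_cthickening_of_dist_le _ v r A hv (by rw [dist_comm]; linarith)
      · exact Or.inr ⟨c.stitch, c.stitch_mem, c.entry_mem, c.exit_mem⟩

theorem length_mul_le {δ : ℝ} (hsep : ∀ I ∈ S.stitches, ∀ J ∈ S.stitches, I ≠ J →
    ∀ x ∈ I, ∀ y ∈ J, δ ≤ dist x y) (w : EuclideanSpace ℝ (Fin N)) (l : List S.Crossing)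
    (c : S.Crossing) (h : Admissible (c :: l)) : l.length * δ ≤ pathLength c.exit w l := by
  induction l generalizing c with
  | nil => simp [pathLength]
  | cons d l ih =>
    simp only [Admissible, List.isChain_cons_cons] at h
    have h1 := ih d h.2
    have h2 := hsep _ c.stitch_mem _ d.stitch_mem h.1 _ c.exit_mem _ d.entry_mem
    simp only [List.length_cons, pathLength]
    push_cast
    linarith

theorem isBounded_preimage_closedBall (p : S.Space) (R : ℝ) :
    Bornology.IsBounded (S.proj ⁻¹' Metric.closedBall p R) := by
  obtain ⟨δ, hδ, hsep⟩ := S.separated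
  obtain ⟨v, rfl⟩ := S.proj_surjective p
  obtain ⟨n, hn⟩ := exists_nat_ge ((R + 1) / δ)
  rw [div_le_iff₀ hδ] at hn
  have hb := S.isBounded_saturation (S.isBounded_endpoints (R + 1) (n + 1) _
    (S.isBounded_saturation (Bornology.isBounded_singleton (x := v))))
  refine hb.subset fun w hw => ?_
  rw [Set.mem_preimage, Metric.mem_closedBall, dist_comm] at hw
  obtain ⟨v', w', l, hv, hw', hl, hlt⟩ :=
    exists_pathLength_lt (hw.trans_lt (lt_add_one R))
  refine ⟨w', ⟨v', ⟨v, rfl, S.proj_eq_iff.1 hv.symm⟩, l, ?_, hlt.le⟩, S.proj_eq_iff.1 hw'⟩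
  cases l with
  | nil => simp
  | cons c l =>
    have h1 := length_mul_le hsep w' l c hl
    have h2 := dist_nonneg (x := v') (y := c.entry)
    simp only [pathLength] at hlt
    have h3 : (l.length : ℝ) ≤ n := le_of_mul_le_mul_right (by linarith) hδ
    simpa using (Nat.cast_le.1 h3)

/-- Closed balls of a smocked space are compact. -/
instance : ProperSpace S.Space where
  isCompact_closedBall p R := by
    rw [← Set.image_preimage_eq (Metric.closedBall p R) S.proj_surjective]
    exact (Metric.isCompact_of_isClosed_isBounded
      (Metric.isClosed_closedBall.preimage continuous_proj)
      (isBounded_preimage_closedBall p R)).image continuous_proj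

variable (S) in
/-- The union of the stitches that meet the closed ball of radius `R` about the origin. -/
def unionMeeting (R : ℝ) : Set (EuclideanSpace ℝ (Fin N)) :=
  ⋃₀ {I ∈ S.stitches | (I ∩ Metric.closedBall 0 R).Nonempty}

end Smocking

/-- Gromov-Hausdorff distance of the closed balls of radius `R` about `x` and `y`
(these are compact, as the spaces are proper, and nonempty for `0 ≤ R`). -/
noncomputable def closedBallGHDist {X Y : Type*} [MetricSpace X] [ProperSpace X] [MetricSpace Y]
    [ProperSpace Y] (x : X) (y : Y) (R : ℝ) (hR : 0 ≤ R) : ℝ :=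
  haveI : Nonempty (Metric.closedBall x R) := ⟨⟨x, Metric.mem_closedBall_self hR⟩⟩
  haveI : Nonempty (Metric.closedBall y R) := ⟨⟨y, Metric.mem_closedBall_self hR⟩⟩
  GromovHausdorff.ghDist (Metric.closedBall x R) (Metric.closedBall y R)

/-- Pointed Gromov-Hausdorff convergence `(X k, x k) → (Y, y)` of proper metric spaces: for every
`R > 0` the closed balls of radius `R` about the base points converge in the Gromov-Hausdorff
sense. -/
def PointedGHTendsto {X : ℕ → Type*} [∀ k, MetricSpace (X k)] [∀ k, ProperSpace (X k)]
    (x : ∀ k, X k) {Y : Type*} [MetricSpace Y] [ProperSpace Y] (y : Y) : Prop :=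
  ∀ (R : ℝ) (hR : 0 < R),
    Filter.Tendsto (fun k => closedBallGHDist (x k) y R hR.le) Filter.atTop (nhds 0)

/-! A path of `S` is turned into a path of `S'` at little extra cost. If the unions of stitches
meeting a large ball are `ε`-close and the stitches of `S'` there are `δ`-separated with `2 * ε ≤
δ`, connectedness forces each such stitch of `S` to lie near a single stitch of `S'`
(`Shadows.of_hausdorffEDist_lt`). Replacing a stitch by its shadow costs at most `2 * ε`. In an
admissible path the segment between two stitches of `S` has length at least `δ`, so it absorbs this
cost as a factor `1 + 2 * ε / δ`, however many stitches are crossed (`dist_le_of_shadow`,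
`dist_le_of_shadows`).

The path must stay where the hypotheses apply. Its progress is measured in `S'`, whose balls have
bounded preimages. For `S' = T` this is properness; for `S' = S k` a bound uniform in `k` is needed,
and the comparison with `T` already proved supplies it (`exists_eventually_norm_le`).

So the two distances, pulled back to Euclidean space, eventually differ by at most `η` on large
balls. Cutting paths moves points just outside a ball of radius `R` into it, which gives an
approximate isometry between the balls (`closedBallGHDist_le`). -/

namespace Smocking

/-! ### Choosing and cutting paths -/

/-- Any two prescribed representatives are joined by admissible paths of nearly minimal length. -/
theorem exists_admissible_pathLength_lt {N : ℕ} {S : Smocking N} {v w : EuclideanSpace ℝ (Fin N)}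
    {a : ℝ} (h : dist (S.proj v) (S.proj w) < a) :
    ∃ l : List S.Crossing, Admissible l ∧ pathLength v w l < a := by
  suffices ∃ l : List S.Crossing, pathLength v w l < a by
    obtain ⟨l, hl⟩ := this
    obtain ⟨m, hm, hle⟩ := exists_admissible v w l
    exact ⟨m, hm, hle.trans_lt hl⟩
  obtain ⟨v', w', l, hv, hw, -, hl⟩ := exists_pathLength_lt h
  -- Changing the representative of an endpoint is one more crossing, of zero cost.
  have hend : ∃ m : List S.Crossing, pathLength v' w m < a := by
    rcases S.proj_eq_iff.1 hw with rfl | ⟨J, hJ, h1, h2⟩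
    · exact ⟨l, hl⟩
    · refine ⟨l ++ [⟨J, hJ, w', w, h1, h2⟩], ?_⟩
      rw [pathLength_append_cons]
      simpa [pathLength] using hl
  obtain ⟨m, hm⟩ := hend
  rcases S.proj_eq_iff.1 hv with rfl | ⟨I, hI, h1, h2⟩
  · exact ⟨m, hm⟩
  · refine ⟨⟨I, hI, v, v', h2, h1⟩ :: m, ?_⟩
    simpa [pathLength] using hm

/-- A path can be cut at any prescribed length. -/
theorem exists_dist_le_of_pathLength_le {N : ℕ} {S : Smocking N} {w : EuclideanSpace ℝ (Fin N)}
    (l : List S.Crossing) {b : ℝ} (hb : 0 ≤ b) :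
    ∀ (v : EuclideanSpace ℝ (Fin N)) {a : ℝ}, 0 ≤ a → pathLength v w l ≤ a + b →
      ∃ u, dist (S.proj v) (S.proj u) ≤ a ∧ dist (S.proj u) (S.proj w) ≤ b := by
  induction l with
  | nil =>
    intro v a ha h
    obtain ⟨u, h1, h2⟩ := exists_dist_le_le ha hb (show dist v w ≤ b + a by
      simpa [pathLength, add_comm] using h)
    exact ⟨u, (dist_proj_le _ _).trans h1, (dist_proj_le _ _).trans h2⟩
  | cons c l ih =>
    intro v a ha h
    simp only [pathLength] at h
    have hc : S.proj c.entry = S.proj c.exit :=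
      S.proj_eq_iff.2 (Or.inr ⟨c.stitch, c.stitch_mem, c.entry_mem, c.exit_mem⟩)
    have hvc := dist_proj_le (S := S) v c.entry
    by_cases hle : dist v c.entry ≤ a
    · obtain ⟨u, h1, h2⟩ := ih c.exit (sub_nonneg.2 hle) (by linarith)
      have h3 := dist_triangle (S.proj v) (S.proj c.entry) (S.proj u)
      rw [← hc] at h1
      exact ⟨u, by linarith, h2⟩
    · push Not at hle
      obtain ⟨u, h1, h2⟩ := exists_dist_le_le ha (sub_nonneg.2 hle.le)
        (show dist v c.entry ≤ dist v c.entry - a + a by linarith)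
      refine ⟨u, (dist_proj_le _ _).trans h1, ?_⟩
      have h3 := dist_triangle (S.proj u) (S.proj c.entry) (S.proj w)
      have h4 := dist_proj_le (S := S) u c.entry
      have h5 := dist_le_pathLength c.exit w l
      rw [← hc] at h5
      linarith

/-- Cut a nearly minimal path at length `R`. The infimum need not be attained, hence `2 * η` in
place of `η`. -/
theorem exists_mem_closedBall_dist_le {N : ℕ} {S : Smocking N} {p q : S.Space} {R η : ℝ}
    (hR : 0 ≤ R) (hη : 0 < η) (h : dist p q ≤ R + η) :
    ∃ q', dist p q' ≤ R ∧ dist q' q ≤ 2 * η := by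
  obtain ⟨v, w, l, rfl, rfl, -, hl⟩ :=
    exists_pathLength_lt (show dist p q < R + 2 * η by linarith)
  obtain ⟨u, h1, h2⟩ := exists_dist_le_of_pathLength_le l (by positivity) v hR hl.le
  exact ⟨_, h1, h2⟩

/-! ### Shadows of stitches -/

/-- Each stitch of `S` meeting the closed ball of radius `R` lies within `ε` of a single class
of `S'`. -/
def Shadows {N : ℕ} (S S' : Smocking N) (R ε : ℝ) : Prop :=
  ∀ I ∈ S.stitches, (I ∩ Metric.closedBall 0 R).Nonempty →
    ∃ p : S'.Space, ∀ x ∈ I, ∃ y, S'.proj y = p ∧ dist x y ≤ ε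

/-- Distinct stitches meeting the closed ball of radius `R` have distance at least `δ`. -/
def SeparatedOn {N : ℕ} (S : Smocking N) (R δ : ℝ) : Prop :=
  ∀ I ∈ S.stitches, ∀ J ∈ S.stitches, (I ∩ Metric.closedBall 0 R).Nonempty →
    (J ∩ Metric.closedBall 0 R).Nonempty → I ≠ J → ∀ x ∈ I, ∀ y ∈ J, δ ≤ dist x y

/-- The open `ε`-thickenings of the stitches of `S'` meeting the ball cover `I` and are disjoint
since `2 * ε ≤ δ`; a connected `I` lies in only one of them. -/
theorem Shadows.of_hausdorffEDist_lt {N : ℕ} {S S' : Smocking N} {R δ ε : ℝ}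
    (hsep : S'.SeparatedOn R δ) (hεδ : 2 * ε ≤ δ)
    (h : Metric.hausdorffEDist (S.unionMeeting R) (S'.unionMeeting R) < ENNReal.ofReal ε) :
    S.Shadows S' R ε := by
  intro I hI hIR
  have hnear : ∀ x ∈ I, ∃ J ∈ S'.stitches, (J ∩ Metric.closedBall 0 R).Nonempty ∧
      x ∈ Metric.thickening ε J := by
    intro x hx
    obtain ⟨y, ⟨J, ⟨hJ, hJR⟩, hyJ⟩, hxy⟩ := Metric.exists_edist_lt_of_hausdorffEDist_lt
      (show x ∈ S.unionMeeting R from ⟨I, ⟨hI, hIR⟩, hx⟩) h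
    refine ⟨J, hJ, hJR, Metric.mem_thickening_iff.2 ⟨y, hyJ, ?_⟩⟩
    rw [edist_dist] at hxy
    exact (ENNReal.ofReal_lt_ofReal_iff_of_nonneg dist_nonneg).1 hxy
  obtain ⟨x₀, hx₀⟩ := (S.isConnected I hI).nonempty
  obtain ⟨J, hJ, hJR, hxJ⟩ := hnear x₀ hx₀
  have hsub : I ⊆ Metric.thickening ε J := by
    refine IsPreconnected.subset_left_of_subset_union
      (v := ⋃ K ∈ {K ∈ S'.stitches | (K ∩ Metric.closedBall 0 R).Nonempty ∧ K ≠ J},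
        Metric.thickening ε K) Metric.isOpen_thickening
      (isOpen_biUnion fun _ _ => Metric.isOpen_thickening) ?_ ?_ ⟨x₀, hx₀, hxJ⟩
      (S.isConnected I hI).isPreconnected
    · rw [Set.disjoint_left]
      intro x hx hx'
      obtain ⟨K, ⟨hK, hKR, hKJ⟩, hxK⟩ := Set.mem_iUnion₂.1 hx'
      obtain ⟨y, hy, hxy⟩ := Metric.mem_thickening_iff.1 hx
      obtain ⟨z, hz, hxz⟩ := Metric.mem_thickening_iff.1 hxK
      have h1 := hsep K hK J hJ hKR hJR hKJ z hz y hy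
      have h2 := dist_triangle_left z y x
      linarith
    · intro x hx
      obtain ⟨K, hK, hKR, hxK⟩ := hnear x hx
      by_cases hKJ : K = J
      · exact Or.inl (hKJ ▸ hxK)
      · exact Or.inr (Set.mem_iUnion₂.2 ⟨K, ⟨hK, hKR, hKJ⟩, hxK⟩)
  obtain ⟨y₀, hy₀⟩ := (S'.isConnected J hJ).nonempty
  refine ⟨S'.proj y₀, fun x hx => ?_⟩
  obtain ⟨y, hy, hxy⟩ := Metric.mem_thickening_iff.1 (hsub hx)
  exact ⟨y, S'.proj_eq_iff.2 (Or.inr ⟨J, hJ, hy, hy₀⟩), hxy.le⟩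

theorem dist_proj_le_of_near {N : ℕ} {S : Smocking N} {x y : EuclideanSpace ℝ (Fin N)}
    {p : S.Space} {ε : ℝ} (hy : S.proj y = p) (h : dist x y ≤ ε) : dist (S.proj x) p ≤ ε :=
  hy ▸ (dist_proj_le x y).trans h

/-! ### Transport of paths -/

/-- The induction step of path transport: the path starts at the exit of the crossing `c`, whose
stitch is shadowed by `p`. -/
theorem dist_le_of_shadow {N : ℕ} {S S' : Smocking N} {R R₀ M ε δ : ℝ} (hδ : 0 < δ)
    (hε : 0 ≤ ε) (hR : R₀ + ε + M ≤ R)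
    (hbdd : ∀ u, dist (S'.proj 0) (S'.proj u) ≤ M → ‖u‖ ≤ R₀)
    (hsh : S.Shadows S' R ε) (hsep : S.SeparatedOn R δ) (w : EuclideanSpace ℝ (Fin N))
    (l : List S.Crossing) :
    ∀ (c : S.Crossing) (p : S'.Space), Admissible (c :: l) →
      (c.stitch ∩ Metric.closedBall 0 R).Nonempty →
      (∀ x ∈ c.stitch, ∃ y, S'.proj y = p ∧ dist x y ≤ ε) →
      dist (S'.proj 0) p + (1 + 2 * ε / δ) * pathLength c.exit w l ≤ M →
      dist p (S'.proj w) ≤ (1 + 2 * ε / δ) * pathLength c.exit w l + ε := by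
  have hκ : 0 ≤ 2 * ε / δ := by positivity
  induction l with
  | nil =>
    intro c p _ _ hp _
    obtain ⟨y, hy, hxy⟩ := hp _ c.exit_mem
    have h1 := dist_proj_le_of_near hy hxy
    have h2 := dist_proj_le (S := S') c.exit w
    have h3 := dist_triangle_left p (S'.proj w) (S'.proj c.exit)
    have h4 := mul_nonneg hκ (dist_nonneg (x := c.exit) (y := w))
    simp only [pathLength]
    linarith
  | cons d l ih =>
    intro c p hl hcR hp hM
    simp only [Admissible, List.isChain_cons_cons] at hl
    simp only [pathLength] at hM ⊢
    obtain ⟨y, hy, hxy⟩ := hp _ c.exit_mem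
    have hs := dist_nonneg (x := c.exit) (y := d.entry)
    have hl0 := pathLength_nonneg d.exit w l
    have hκs := mul_nonneg hκ hs
    have hκl := mul_nonneg hκ hl0
    have hp0 := dist_nonneg (x := S'.proj 0) (y := p)
    -- Localisation: `p` is within `M` of the base class, so its representative `y` has norm at most
    -- `R₀`. The exit is within `ε` of `y` and the next entry within `M` of the exit, so the next
    -- stitch meets the ball of radius `R`.
    have hy0 : ‖y‖ ≤ R₀ := hbdd y (by rw [hy]; linarith)
    have hdR : d.entry ∈ Metric.closedBall 0 R := by
      rw [mem_closedBall_zero_iff, ← dist_zero_right]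
      rw [← dist_zero_right] at hy0
      have h1 := dist_triangle d.entry c.exit 0
      have h2 := dist_triangle c.exit y 0
      rw [dist_comm d.entry c.exit] at h1
      linarith
    have hd : (d.stitch ∩ Metric.closedBall 0 R).Nonempty := ⟨_, d.entry_mem, hdR⟩
    obtain ⟨q, hq⟩ := hsh _ d.stitch_mem hd
    obtain ⟨z, hz, hez⟩ := hq _ d.entry_mem
    have hgap := hsep _ c.stitch_mem _ d.stitch_mem hcR hd hl.1 _ c.exit_mem _ d.entry_mem
    -- Leaving one shadow and reaching the next costs `2 * ε`, paid for by the gap `δ`.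
    have h2ε : 2 * ε ≤ 2 * ε / δ * dist c.exit d.entry := by
      rw [div_mul_eq_mul_div, le_div_iff₀ hδ]
      exact mul_le_mul_of_nonneg_left hgap (by positivity)
    have hpq : dist p q ≤ (1 + 2 * ε / δ) * dist c.exit d.entry := by
      have h1 := dist_proj_le_of_near hy hxy
      have h2 := dist_proj_le_of_near hz hez
      have h3 := dist_proj_le (S := S') c.exit d.entry
      have h4 := dist_triangle_left p q (S'.proj c.exit)
      have h5 := dist_triangle (S'.proj c.exit) (S'.proj d.entry) q
      linarith
    have h0q := dist_triangle (S'.proj 0) p q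
    -- The budget `M` is preserved: the distance from the base class grows by no more than the
    -- weighted remaining length drops.
    have hrec := ih d q hl.2 hd hq (by linarith)
    have h6 := dist_triangle p q (S'.proj w)
    linarith

/-- The first segment may be arbitrarily short and absorbs nothing, so reaching the first shadow
adds `ε`; leaving the last one adds the other. -/
theorem dist_le_of_shadows {N : ℕ} {S S' : Smocking N} {R R₀ M ε δ a : ℝ} (hδ : 0 < δ)
    (hε : 0 ≤ ε) (hR : R₀ + ε + M ≤ R)
    (hbdd : ∀ u, dist (S'.proj 0) (S'.proj u) ≤ M → ‖u‖ ≤ R₀)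
    (hsh : S.Shadows S' R ε) (hsep : S.SeparatedOn R δ) {v w : EuclideanSpace ℝ (Fin N)}
    (ha : dist (S.proj v) (S.proj w) < a)
    (hM : dist (S'.proj 0) (S'.proj v) + ε + (1 + 2 * ε / δ) * a ≤ M) :
    dist (S'.proj v) (S'.proj w) ≤ (1 + 2 * ε / δ) * a + 2 * ε := by
  have hκ : 0 ≤ 2 * ε / δ := by positivity
  obtain ⟨l, hl, hla⟩ := exists_admissible_pathLength_lt ha
  have hmul : (1 + 2 * ε / δ) * pathLength v w l ≤ (1 + 2 * ε / δ) * a :=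
    mul_le_mul_of_nonneg_left hla.le (by linarith)
  cases l with
  | nil =>
    have h1 := dist_proj_le (S := S') v w
    have h2 := mul_nonneg hκ (dist_nonneg (x := v) (y := w))
    simp only [pathLength] at hmul
    linarith
  | cons c l =>
    simp only [pathLength] at hmul
    have hs := dist_nonneg (x := v) (y := c.entry)
    have hκs := mul_nonneg hκ hs
    have hl0 := pathLength_nonneg c.exit w l
    have hκl := mul_nonneg hκ hl0
    have h00 := dist_nonneg (x := S'.proj 0) (y := S'.proj v)
    have hv0 : ‖v‖ ≤ R₀ := hbdd v (by linarith)
    have hcR : c.entry ∈ Metric.closedBall 0 R := by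
      rw [mem_closedBall_zero_iff, ← dist_zero_right]
      rw [← dist_zero_right] at hv0
      have h1 := dist_triangle_left c.entry 0 v
      linarith
    have hc : (c.stitch ∩ Metric.closedBall 0 R).Nonempty := ⟨_, c.entry_mem, hcR⟩
    obtain ⟨p, hp⟩ := hsh _ c.stitch_mem hc
    obtain ⟨y, hy, hxy⟩ := hp _ c.entry_mem
    have h1 := dist_proj_le_of_near hy hxy
    have h2 := dist_proj_le (S := S') v c.entry
    have h3 := dist_triangle (S'.proj v) (S'.proj c.entry) p
    have h4 := dist_triangle (S'.proj 0) (S'.proj v) p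
    have h5 := dist_le_of_shadow hδ hε hR hbdd hsh hsep w l c p hl hc hp (by linarith)
    have h6 := dist_triangle (S'.proj v) p (S'.proj w)
    linarith

/-! ### Comparison of the distances -/

/-- On the classes at distance at most `M` from the base class, the smocked distance of `S'` is at
most the smocked distance of `S` plus `η`. -/
def DistLe {N : ℕ} (S S' : Smocking N) (M η : ℝ) : Prop :=
  ∀ v w, dist (S.proj 0) (S.proj v) ≤ M → dist (S.proj 0) (S.proj w) ≤ M →
    dist (S'.proj v) (S'.proj w) ≤ dist (S.proj v) (S.proj w) + η

theorem DistLe.of_shadows {N : ℕ} {S S' : Smocking N} {R₀ M η ε δ : ℝ} (hM : 0 ≤ M)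
    (hη : 0 < η) (hη1 : η ≤ 1) (hδ : 0 < δ) (hε : 0 ≤ ε) (hε8 : 8 * ε ≤ η)
    (hεδ : 2 * ε * (4 * (2 * M + 1)) ≤ η * δ)
    (hbdd : ∀ u, dist (S'.proj 0) (S'.proj u) ≤ 3 * M + 5 → ‖u‖ ≤ R₀)
    (hsh : S.Shadows S' (R₀ + 3 * M + 6) ε) (hsep : S.SeparatedOn (R₀ + 3 * M + 6) δ) :
    S.DistLe S' M η := by
  have hκ : 0 ≤ 2 * ε / δ := by positivity
  have hκM : 2 * ε / δ * (4 * (2 * M + 1)) ≤ η := by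
    rw [div_mul_eq_mul_div, div_le_iff₀ hδ]
    exact hεδ
  -- Two points of the `M`-ball are at distance at most `2 * M`. The slack `η / 4` of the path, its
  -- stretching and `2 * ε` each contribute at most `η / 4`.
  have key : ∀ v w, dist (S.proj v) (S.proj w) ≤ 2 * M →
      dist (S'.proj 0) (S'.proj v) ≤ M + 1 →
      dist (S'.proj v) (S'.proj w) ≤ dist (S.proj v) (S.proj w) + η := by
    intro v w hvw hv
    have h1 : 2 * ε / δ * (dist (S.proj v) (S.proj w) + η / 4) ≤ 2 * ε / δ * (2 * M + 1) :=
      mul_le_mul_of_nonneg_left (by linarith) hκ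
    have h2 := dist_le_of_shadows (v := v) (w := w) (a := dist (S.proj v) (S.proj w) + η / 4) hδ hε
      (show R₀ + ε + (3 * M + 5) ≤ R₀ + 3 * M + 6 by linarith) hbdd hsh hsep (by linarith)
      (by linarith)
    linarith
  intro v w hv hw
  -- The bound on `v` in `S'` that `key` requires comes from `key` itself, applied from the origin.
  refine key v w ?_ ?_
  · have := dist_triangle_left (S.proj v) (S.proj w) (S.proj 0)
    linarith
  · have := key 0 v (by linarith) (by rw [dist_self]; linarith)
    linarith

theorem exists_norm_le_of_dist_le {N : ℕ} (S : Smocking N) (M : ℝ) :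
    ∃ R₀, 0 ≤ R₀ ∧ ∀ u, dist (S.proj 0) (S.proj u) ≤ M → ‖u‖ ≤ R₀ := by
  obtain ⟨C, hC⟩ := isBounded_iff_forall_norm_le.1 (isBounded_preimage_closedBall (S.proj 0) M)
  refine ⟨max C 0, le_max_right _ _, fun u hu => (hC u ?_).trans (le_max_left _ _)⟩
  rwa [Set.mem_preimage, Metric.mem_closedBall, dist_comm]

/-! ### Gromov-Hausdorff distance of balls -/

/-- Send `p` to the class in `S'` of a representative, pushed back into the ball at cost `2 * η`.
Radius `R + 1` leaves room for points that the change of metric moves out of the ball. -/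
theorem closedBallGHDist_le {N : ℕ} {S S' : Smocking N} {R η : ℝ} (hR : 0 ≤ R) (hη : 0 < η)
    (hη1 : η ≤ 1) (h : S.DistLe S' (R + 1) η) (h' : S'.DistLe S (R + 1) η) :
    closedBallGHDist (S.proj 0) (S'.proj 0) R hR ≤ 8 * η := by
  have hex : ∀ p : Metric.closedBall (S.proj 0) R, ∃ (v : EuclideanSpace ℝ (Fin N))
      (q : Metric.closedBall (S'.proj 0) R), S.proj v = p ∧ dist (S.proj 0) (S.proj v) ≤ R ∧
        dist (S'.proj 0) (S'.proj v) ≤ R + 1 ∧ dist (q : S'.Space) (S'.proj v) ≤ 2 * η := by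
    rintro ⟨p, hp⟩
    obtain ⟨v, rfl⟩ := S.proj_surjective p
    rw [Metric.mem_closedBall, dist_comm] at hp
    have h1 := h 0 v (by rw [dist_self]; linarith) (by linarith)
    obtain ⟨q, hq, hqv⟩ := exists_mem_closedBall_dist_le hR hη
      (show dist (S'.proj 0) (S'.proj v) ≤ R + η by linarith)
    exact ⟨v, ⟨q, by rwa [Metric.mem_closedBall, dist_comm]⟩, rfl, hp, by linarith, hqv⟩
  choose f Φ hf hfR hfR' hΦ using hex
  have : Nonempty (Metric.closedBall (S.proj 0) R) := ⟨⟨_, Metric.mem_closedBall_self hR⟩⟩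
  have : Nonempty (Metric.closedBall (S'.proj 0) R) := ⟨⟨_, Metric.mem_closedBall_self hR⟩⟩
  have hgh := GromovHausdorff.ghDist_le_of_approx_subsets (X := Metric.closedBall (S.proj 0) R)
    (Y := Metric.closedBall (S'.proj 0) R) (s := Set.univ) (fun p => Φ p) (ε₁ := 0)
    (ε₂ := 5 * η) (ε₃ := 5 * η) (fun p => ⟨p, trivial, (dist_self p).le⟩) ?_ ?_
  -- The bound obtained is `0 + 5 * η / 2 + 5 * η`.
  · exact hgh.trans (by linarith)
  · rintro ⟨q, hq⟩
    obtain ⟨w, rfl⟩ := S'.proj_surjective q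
    rw [Metric.mem_closedBall, dist_comm] at hq
    have h1 := h' 0 w (by rw [dist_self]; linarith) (by linarith)
    obtain ⟨p, hp, hpw⟩ := exists_mem_closedBall_dist_le hR hη
      (show dist (S.proj 0) (S.proj w) ≤ R + η by linarith)
    have hp' : p ∈ Metric.closedBall (S.proj 0) R := by rwa [Metric.mem_closedBall, dist_comm]
    refine ⟨⟨⟨p, hp'⟩, trivial⟩, ?_⟩
    -- Density: `2 * η` in `S` becomes `3 * η` in `S'`, and the push adds `2 * η`.
    have h2 := h w (f ⟨p, hp'⟩) (by linarith) (by linarith [hfR ⟨p, hp'⟩])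
    rw [hf, dist_comm (S.proj w)] at h2
    have h3 := hΦ ⟨p, hp'⟩
    have h4 := dist_triangle_right (S'.proj w) (Φ ⟨p, hp'⟩ : S'.Space) (S'.proj (f ⟨p, hp'⟩))
    change dist (S'.proj w) (Φ ⟨p, hp'⟩ : S'.Space) ≤ 5 * η
    linarith
  · rintro ⟨p, -⟩ ⟨q, -⟩
    change |dist (p : S.Space) q - dist (Φ p : S'.Space) (Φ q)| ≤ 5 * η
    have h1 := h (f p) (f q) (by linarith [hfR p]) (by linarith [hfR q])
    have h2 := h' (f p) (f q) (hfR' p) (hfR' q)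
    rw [hf, hf] at h1 h2
    -- Distortion: `η` from the metrics and `2 * η` from the push at each end.
    have h3 := dist_triangle4 (Φ p : S'.Space) (S'.proj (f p)) (S'.proj (f q)) (Φ q)
    have h3' := dist_triangle4 (S'.proj (f p)) (Φ p : S'.Space) (Φ q) (S'.proj (f q))
    rw [dist_comm (S'.proj (f q))] at h3
    rw [dist_comm (S'.proj (f p)) (Φ p : S'.Space)] at h3'
    have h4 := hΦ p
    have h5 := hΦ q
    rw [abs_sub_le_iff]
    constructor <;> linarith

/-! ### Constants uniform in `k` -/

section Convergence

variable {N : ℕ} {S : ℕ → Smocking N} {T : Smocking N}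

theorem eventually_shadows {R δ ε : ℝ} (hδ : 0 < δ) (hε : 0 < ε)
    (H : Filter.Tendsto (fun k => Metric.hausdorffEDist ((S k).unionMeeting R) (T.unionMeeting R))
      Filter.atTop (nhds 0))
    (hS : ∀ᶠ k in Filter.atTop, (S k).SeparatedOn R δ) (hT : T.SeparatedOn R δ) :
    ∀ᶠ k in Filter.atTop, (S k).Shadows T R ε ∧ T.Shadows (S k) R ε := by
  have hm : 0 < min ε (δ / 2) := lt_min hε (by linarith)
  have hmδ : 2 * min ε (δ / 2) ≤ δ := by linarith [min_le_right ε (δ / 2)]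
  have hmono : ∀ S S' : Smocking N, S.Shadows S' R (min ε (δ / 2)) → S.Shadows S' R ε := by
    intro S S' h I hI hIR
    obtain ⟨p, hp⟩ := h I hI hIR
    refine ⟨p, fun x hx => ?_⟩
    obtain ⟨y, hy, hxy⟩ := hp x hx
    exact ⟨y, hy, hxy.trans (min_le_left _ _)⟩
  filter_upwards [hS, H.eventually (gt_mem_nhds (ENNReal.ofReal_pos.2 hm))] with k hk hlt
  refine ⟨hmono _ _ (.of_hausdorffEDist_lt hT hmδ hlt), hmono _ _ (.of_hausdorffEDist_lt hk hmδ ?_)⟩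
  rwa [Metric.hausdorffEDist_comm]

/-- The norm bounds are premises inside the `∀ᶠ` because the one for `S k` is only derived later,
from the first half. -/
theorem eventually_distLe
    (H1 : ∀ R : ℝ, 0 < R →
      Filter.Tendsto (fun k => Metric.hausdorffEDist ((S k).unionMeeting R) (T.unionMeeting R))
        Filter.atTop (nhds 0))
    (H2 : ∀ R : ℝ, 0 < R → ∃ δ : ℝ, 0 < δ ∧ ∀ᶠ k in Filter.atTop, (S k).SeparatedOn R δ)
    {M η R₀ : ℝ} (hM : 0 ≤ M) (hη : 0 < η) (hη1 : η ≤ 1) (hR₀ : 0 ≤ R₀) :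
    ∀ᶠ k in Filter.atTop,
      ((∀ u, dist (T.proj 0) (T.proj u) ≤ 3 * M + 5 → ‖u‖ ≤ R₀) → (S k).DistLe T M η) ∧
      ((∀ u, dist ((S k).proj 0) ((S k).proj u) ≤ 3 * M + 5 → ‖u‖ ≤ R₀) →
        T.DistLe (S k) M η) := by
  have hR : 0 < R₀ + 3 * M + 6 := by positivity
  obtain ⟨δ₁, hδ₁, hS⟩ := H2 _ hR
  obtain ⟨δ₂, hδ₂, hT⟩ := T.separated
  obtain ⟨δ, hδ, hle₁, hle₂⟩ : ∃ δ, 0 < δ ∧ δ ≤ δ₁ ∧ δ ≤ δ₂ :=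
    ⟨min δ₁ δ₂, lt_min hδ₁ hδ₂, min_le_left _ _, min_le_right _ _⟩
  have hS' : ∀ᶠ k in Filter.atTop, (S k).SeparatedOn (R₀ + 3 * M + 6) δ :=
    hS.mono fun k hk I hI J hJ hIR hJR hIJ x hx y hy =>
      hle₁.trans (hk I hI J hJ hIR hJR hIJ x hx y hy)
  have hT' : T.SeparatedOn (R₀ + 3 * M + 6) δ := fun I hI J hJ _ _ hIJ x hx y hy =>
    hle₂.trans (hT I hI J hJ hIJ x hx y hy)
  have hb : 0 < 2 * (4 * (2 * M + 1)) := by positivity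
  obtain ⟨ε, hε, hε8, hεδ⟩ : ∃ ε, 0 < ε ∧ 8 * ε ≤ η ∧ 2 * ε * (4 * (2 * M + 1)) ≤ η * δ := by
    refine ⟨min (η / 8) (η * δ / (2 * (4 * (2 * M + 1)))), lt_min (by positivity) (by positivity),
      by linarith [min_le_left (η / 8) (η * δ / (2 * (4 * (2 * M + 1))))], ?_⟩
    have := (le_div_iff₀ hb).1 (min_le_right (η / 8) (η * δ / (2 * (4 * (2 * M + 1)))))
    linarith
  filter_upwards [hS', eventually_shadows hδ hε (H1 _ hR) hS' hT'] with k hk hsh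
  exact ⟨fun hB => .of_shadows hM hη hη1 hδ hε.le hε8 hεδ hB hsh.1 hk,
    fun hB => .of_shadows hM hη hη1 hδ hε.le hε8 hεδ hB hsh.2 hT'⟩

/-- With `η = 1`, the `M`-ball of `S k` lies over the `(M + 1)`-ball of `T`, whose preimage is
bounded independently of `k`. -/
theorem exists_eventually_norm_le
    (H1 : ∀ R : ℝ, 0 < R →
      Filter.Tendsto (fun k => Metric.hausdorffEDist ((S k).unionMeeting R) (T.unionMeeting R))
        Filter.atTop (nhds 0))
    (H2 : ∀ R : ℝ, 0 < R → ∃ δ : ℝ, 0 < δ ∧ ∀ᶠ k in Filter.atTop, (S k).SeparatedOn R δ)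
    {M : ℝ} (hM : 0 ≤ M) :
    ∃ R₀, 0 ≤ R₀ ∧ ∀ᶠ k in Filter.atTop,
      ∀ u, dist ((S k).proj 0) ((S k).proj u) ≤ M → ‖u‖ ≤ R₀ := by
  obtain ⟨R₀, hR₀, hB⟩ := T.exists_norm_le_of_dist_le (3 * M + 5)
  refine ⟨R₀, hR₀, ?_⟩
  filter_upwards [eventually_distLe H1 H2 hM one_pos le_rfl hR₀] with k hk u hu
  have h1 := hk.1 hB 0 u (by rwa [dist_self]) hu
  exact hB u (by linarith)

end Convergence

end Smocking

theorem proposition3p3 {N : ℕ} (S : ℕ → Smocking N) (T : Smocking N)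
    (H1 : ∀ R : ℝ, 0 < R →
      Filter.Tendsto (fun k => Metric.hausdorffEDist ((S k).unionMeeting R) (T.unionMeeting R))
        Filter.atTop (nhds 0))
    (H2 : ∀ R : ℝ, 0 < R → ∃ (L δ : ℝ) (K : ℕ), 0 < δ ∧ ∀ k, K ≤ k →
      (∀ I ∈ (S k).stitches, (I ∩ Metric.closedBall 0 R).Nonempty → Metric.diam I ≤ L) ∧
      (∀ I ∈ (S k).stitches, ∀ J ∈ (S k).stitches,
        (I ∩ Metric.closedBall 0 R).Nonempty → (J ∩ Metric.closedBall 0 R).Nonempty → I ≠ J →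
          ∀ x ∈ I, ∀ y ∈ J, δ ≤ dist x y)) :
    PointedGHTendsto (fun k => (S k).proj 0) (T.proj 0) := by
  have H2' : ∀ R : ℝ, 0 < R →
      ∃ δ : ℝ, 0 < δ ∧ ∀ᶠ k in Filter.atTop, (S k).SeparatedOn R δ := by
    intro R hR
    obtain ⟨L, δ, K, hδ, h⟩ := H2 R hR
    exact ⟨δ, hδ, Filter.eventually_atTop.2 ⟨K, fun k hk => (h k hk).2⟩⟩
  intro R hR
  obtain ⟨R₁, hR₁, hB₁⟩ := T.exists_norm_le_of_dist_le (3 * (R + 1) + 5)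
  obtain ⟨R₂, hR₂, hB₂⟩ := Smocking.exists_eventually_norm_le H1 H2'
    (show 0 ≤ 3 * (R + 1) + 5 by positivity)
  rw [Metric.tendsto_nhds]
  intro ε hε
  -- The final bound is `8 * η ≤ 8 * ε / 9 < ε`.
  have hη : 0 < min 1 (ε / 9) := lt_min one_pos (by positivity)
  have hη1 : min 1 (ε / 9) ≤ 1 := min_le_left _ _
  have hM : 0 ≤ R + 1 := by positivity
  filter_upwards [hB₂, Smocking.eventually_distLe H1 H2' hM hη hη1 hR₁,
    Smocking.eventually_distLe H1 H2' hM hη hη1 hR₂] with k hk h1 h2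
  have hle := Smocking.closedBallGHDist_le hR.le hη hη1 (h1.1 hB₁) (h2.2 hk)
  have hnonneg : 0 ≤ closedBallGHDist ((S k).proj 0) (T.proj 0) R hR.le := dist_nonneg
  rw [Real.dist_0_eq_abs, abs_of_nonneg hnonneg]
  linarith [min_le_right 1 (ε / 9)]
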